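/- Let $r\ge 1$ and $\ell\ge 1$ be integers, $\underline x=(x_1,\dots,x_r)$, and let $\mathcal P_j=\{P_{j1}(\underline x),\dots,P_{js_j}(\underline x)\}$, $j=1,\dots,\ell$, be $\ell$ finite families of nonzero polynomials in $\mathbb Z[\underline x]$, each family being coprime. Here a finite family $S\subset\mathbb Z[\underline x]$ is called coprime if no polynomial $D\in\mathbb Q[\underline x]$ with $\deg D>0$ divides all members of $S$ in $\mathbb Q[\underline x]$. For such a finite family $S$ put $$\mathcal R(S)=\{\underline n\in\mathbb Z^r \mid \gcd_{P\in S} P(\underline n)=1\},$$ and let $\mathcal R=\bigcap_{j=1}^{\ell}\mathcal R(\mathcal P_j)$. The density of a set $T\subset\mathbb Z^r$ is $$\mu(T)=\lim_{B\to+\infty}\frac{\#\big(T\cap\{0,\dots,B-1\}^r\big)}{B^r}$$ when this limit exists. Let $\Pi\subset\mathbb Z[\underline x]$ be the set of all products $A_1\cdots A_\ell$ with $A_j\in\mathcal P_j$ for $j=1,\dots,\ell$, and for a prime $p$ let $$c_p=\#\{\underline n\in(\mathbb Z/p\mathbb Z)^r \mid Q(\underline n)=0 \text{ in } \mathbb Z/p\mathbb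 Z \text{ for all } Q\in\Pi\}.$$ Then: (a) The elements of $\Pi$ are nonzero, and $\Pi$ is coprime. (b) $\mathcal R=\mathcal R(\Pi)$. (c) The density $\mu(\mathcal R)$ exists and $$\mu(\mathcal R)=\prod_{p\text{ prime}}\left(1-\frac{c_p}{p^r}\right),$$ where the product is the limit of its finite partial products (over finite sets of primes, ordered by inclusion), a limit which exists and may be $0$. (d) For every prime $p$, we have $c_p=p^r$ if and only if for every $\underline n\in\mathbb Z^r$ there exists $j\in\{1,\dots,\ell\}$ such that $p$ divides all the values $P_{j1}(\underline n),\dots,P_{js_j}(\underline n)$. -/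

import Mathlib

open Filter Topology

namespace PolyFamilies

/-- The polynomials of the finite family `S ⊂ ℤ[x₁, …, x_r]` are coprime (over `ℚ`): no polynomial
`D ∈ ℚ[x₁, …, x_r]` of positive degree divides all of them. -/
def CoprimePolys {r : ℕ} (S : Finset (MvPolynomial (Fin r) ℤ)) : Prop :=
  ¬ ∃ D : MvPolynomial (Fin r) ℚ, 0 < D.totalDegree ∧
    ∀ P ∈ S, D ∣ MvPolynomial.map (Int.castRingHom ℚ) P

/-- The good set `R(S)`: the points of `ℤ^r` at which the values of the members of `S` have
gcd equal to `1`. -/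
def goodSet {r : ℕ} (S : Finset (MvPolynomial (Fin r) ℤ)) : Set (Fin r → ℤ) :=
  {n | S.gcd (fun P => MvPolynomial.eval n P) = 1}

/-- The set `Π` of all products `A₁ ⋯ A_ℓ` with `A_j ∈ F j`. -/
noncomputable def products {r ℓ : ℕ} (F : Fin ℓ → Finset (MvPolynomial (Fin r) ℤ)) :
    Finset (MvPolynomial (Fin r) ℤ) :=
  (Fintype.piFinset F).image (fun A => ∏ j, A j)

/-- The box `{0, …, B - 1}^r`. -/
def box (r B : ℕ) : Set (Fin r → ℤ) :=
  {n | ∀ i, 0 ≤ n i ∧ n i < (B : ℤ)}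

/-- The density `μ(S)` exists and equals `δ`. -/
def HasDensity {r : ℕ} (S : Set (Fin r → ℤ)) (δ : ℝ) : Prop :=
  Tendsto (fun B : ℕ => ((S ∩ box r B).ncard : ℝ) / ((box r B).ncard : ℝ)) atTop (𝓝 δ)

/-- The number `c_p` of common zeros in `(ℤ/pℤ)^r` of the members of `S`. -/
noncomputable def zeroCount {r : ℕ} (S : Finset (MvPolynomial (Fin r) ℤ)) (p : ℕ) : ℕ :=
  {n : Fin r → ZMod p | ∀ Q ∈ S,
    MvPolynomial.eval n (MvPolynomial.map (Int.castRingHom (ZMod p)) Q) = 0}.ncard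

end PolyFamilies

namespace PolyFamilies

/-! At a point `n`, a prime divides every product in `products F` exactly when it divides all values
of one of the families: otherwise each family has a member whose value it does not divide, and the
product of these members is a counterexample. Since gcd 1 means having no common prime divisor, this
gives (b) and (d). The same choice, with an irreducible factor over ℚ in place of the prime, gives
the coprimality in (a).

For (c) there remains a single coprime family. Sieving by a finite set of primes yields the finite
product of local factors, by the Chinese remainder theorem (`tendsto_card_sieve`), and these
products decrease to their infimum. Passing to the limit requires that the points where some prime
`p > M` divides all values have upper density tending to 0 as `M` grows. This is
`UnitCommonDivisors.exists_card_largePrimeSet_le`, by induction on the number of variables.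

In the induction step, `UnitCommonDivisors.exists_eliminant` gives a nonzero polynomial `h` without
the variable `x₀`, whose value is divisible by every such `p`. Fibers over points where `p` divides
all coefficients in `x₀` are left to the induction hypothesis, and those with `h(n) = 0` to
Schwartz–Zippel. On the other fibers `x₀` is a root mod `p` of a nonzero polynomial of bounded
degree. For `M < p ≤ B` the conditions on `n` and on `x₀` each cost `O(1/p)`, and `∑ 1/p²` has a
small tail; only boundedly many `p > B` divide `h(n)`, and each leaves boundedly many `x₀`. -/

/-! ### Elimination of one variable -/

open Polynomial in
/-- **Elimination.** Over a unique factorization domain, a family of polynomials all of whose common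
divisors are nonzero constants generates an ideal that contains a nonzero constant. -/
theorem exists_C_mem_span {R : Type*} [CommRing R] [IsDomain R] [UniqueFactorizationMonoid R]
    (S : Set R[X]) (hS : ∀ D : R[X], (∀ f ∈ S, D ∣ f) → D ≠ 0 ∧ D.natDegree = 0) :
    ∃ h : R, h ≠ 0 ∧ C h ∈ Ideal.span S := by
  classical
  let : StrongNormalizationMonoid R := UniqueFactorizationMonoid.strongNormalizationMonoid
  let : NormalizedGCDMonoid R := UniqueFactorizationMonoid.toNormalizedGCDMonoid R
  let : Algebra R[X] (FractionRing R)[X] := Polynomial.algebra R (FractionRing R)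
  have := Polynomial.isLocalization (nonZeroDivisors R) (FractionRing R)
  have halg : ∀ f : R[X], algebraMap R[X] (FractionRing R)[X] f
      = f.map (algebraMap R (FractionRing R)) := fun f => rfl
  have hinj : Function.Injective (algebraMap R (FractionRing R)) :=
    IsFractionRing.injective R (FractionRing R)
  obtain ⟨g, hg⟩ := (inferInstance : (Ideal.map (algebraMap R[X] (FractionRing R)[X])
    (Ideal.span S)).IsPrincipal)
  have hdvd : ∀ f ∈ S, g ∣ f.map (algebraMap R (FractionRing R)) := by
    intro f hf
    have h1 : f.map (algebraMap R (FractionRing R)) ∈ Ideal.span {g} := by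
      rw [Ideal.span, ← hg, ← halg]
      exact Ideal.mem_map_of_mem _ (Ideal.subset_span hf)
    exact Ideal.mem_span_singleton.1 h1
  have hg0 : g ≠ 0 := by
    rintro rfl
    refine (hS 0 fun f hf => ?_).1 rfl
    have := hdvd f hf
    rw [zero_dvd_iff, Polynomial.map_eq_zero_iff hinj] at this
    rw [this]
  -- By Gauss's lemma, the primitive part of `g`, cleared of denominators, divides every member of
  -- `S` already over `R`. So `hS` bounds the degree of `g`.
  set G := IsLocalization.integerNormalization (nonZeroDivisors R) g with hG
  obtain ⟨b, hbM, hb⟩ := IsLocalization.integerNormalization_spec (nonZeroDivisors R) g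
  have hb0 : algebraMap R (FractionRing R) b ≠ 0 := by
    simpa using nonZeroDivisors.ne_zero hbM
  have hbg : G.map (algebraMap R (FractionRing R)) = C (algebraMap R (FractionRing R) b) * g := by
    rw [hb, Polynomial.C_mul']
    simp
  have hunit : IsUnit (C (algebraMap R (FractionRing R) b)) :=
    Polynomial.isUnit_C.2 (IsUnit.mk0 _ hb0)
  have hDg : G.primPart.map (algebraMap R (FractionRing R)) ∣ g := by
    have := Polynomial.map_dvd (algebraMap R (FractionRing R)) G.primPart_dvd
    rw [hbg] at this
    exact (hunit.dvd_mul_left).1 this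
  have hdeg := (hS G.primPart fun f hf =>
    G.isPrimitive_primPart.dvd_of_fraction_map_dvd_fraction_map
      (K := FractionRing R) (hDg.trans (hdvd f hf))).2
  have hgdeg : g.natDegree = 0 := by
    rw [natDegree_primPart, ← Polynomial.natDegree_map_eq_of_injective hinj, hbg,
      Polynomial.natDegree_C_mul hb0] at hdeg
    exact hdeg
  have hgu : IsUnit g := by
    rw [Polynomial.eq_C_of_natDegree_eq_zero hgdeg] at hg0 ⊢
    exact Polynomial.isUnit_C.2 (IsUnit.mk0 _ (by simpa using hg0))
  -- The nonzero constant sought is a common denominator in an expression of 1 as a combination of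
  -- members of `S`.
  have hone : (1 : (FractionRing R)[X]) ∈
      Ideal.map (algebraMap R[X] (FractionRing R)[X]) (Ideal.span S) := by
    rw [hg]
    exact Ideal.mem_span_singleton.2 hgu.dvd
  rw [IsLocalization.mem_map_algebraMap_iff
    ((nonZeroDivisors R).map (C : R →+* R[X])) (FractionRing R)[X]] at hone
  obtain ⟨⟨a, ⟨m, hm⟩⟩, h⟩ := hone
  obtain ⟨c, hc, rfl⟩ := hm
  refine ⟨c, nonZeroDivisors.ne_zero hc, ?_⟩
  rw [one_mul, halg, halg] at h
  have hca : C c = (a : R[X]) := Polynomial.map_injective _ hinj h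
  exact hca ▸ a.2

/-- The common divisors over `ℚ` of the members of `S` are units. In positive dimension this is
`CoprimePolys`; in dimension `0` it says that `S` has a nonzero member. -/
def UnitCommonDivisors {r : ℕ} (S : Finset (MvPolynomial (Fin r) ℤ)) : Prop :=
  ∀ D : MvPolynomial (Fin r) ℚ, (∀ P ∈ S, D ∣ MvPolynomial.map (Int.castRingHom ℚ) P) → IsUnit D

theorem isUnit_iff_rat {r : ℕ} (D : MvPolynomial (Fin r) ℚ) :
    IsUnit D ↔ D ≠ 0 ∧ D.totalDegree = 0 := by
  rw [MvPolynomial.isUnit_iff_totalDegree_of_isReduced]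
  constructor
  · rintro ⟨h, h0⟩
    refine ⟨?_, h0⟩
    rintro rfl
    simp at h
  · rintro ⟨h, h0⟩
    refine ⟨?_, h0⟩
    rw [MvPolynomial.totalDegree_eq_zero_iff_eq_C] at h0
    rw [h0] at h
    refine IsUnit.mk0 _ fun hc => h ?_
    rw [hc, map_zero]

theorem CoprimePolys.unitCommonDivisors {r : ℕ} (hr : 1 ≤ r)
    {S : Finset (MvPolynomial (Fin r) ℤ)} (hS : CoprimePolys S) : UnitCommonDivisors S := by
  intro D hD
  rw [isUnit_iff_rat]
  constructor
  · rintro rfl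
    -- If 0 divides all members, they all vanish, and then a variable divides them too; this needs
    -- `1 ≤ r`.
    refine hS ⟨MvPolynomial.X ⟨0, hr⟩, by simp, fun P hP => ?_⟩
    exact (dvd_zero _).trans (hD P hP)
  · by_contra h
    exact hS ⟨D, Nat.pos_of_ne_zero h, hD⟩

/-- The coefficients of the members of `S`, as polynomials in the variable of index `0`. -/
noncomputable def coeffFamily {r : ℕ} (S : Finset (MvPolynomial (Fin (r + 1)) ℤ)) :
    Finset (MvPolynomial (Fin r) ℤ) := by
  classical
  exact S.biUnion fun f => (MvPolynomial.finSuccEquiv ℤ r f).coeffs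

theorem finSuccEquiv_map {R A : Type*} [CommSemiring R] [CommSemiring A] (φ : R →+* A) {r : ℕ}
    (f : MvPolynomial (Fin (r + 1)) R) :
    MvPolynomial.finSuccEquiv A r (MvPolynomial.map φ f)
      = (MvPolynomial.finSuccEquiv R r f).map (MvPolynomial.map φ) := by
  ext i m
  simp [MvPolynomial.finSuccEquiv_coeff_coeff, MvPolynomial.coeff_map]

/-- A common divisor of the coefficients, viewed as a polynomial constant in the variable of index
0, divides all of `S`. -/
theorem UnitCommonDivisors.coeffFamily {r : ℕ} {S : Finset (MvPolynomial (Fin (r + 1)) ℤ)}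
    (hS : UnitCommonDivisors S) : UnitCommonDivisors (coeffFamily S) := by
  intro D hD
  have hdvd : ∀ P ∈ S, (MvPolynomial.finSuccEquiv ℚ r).symm (Polynomial.C D) ∣
      MvPolynomial.map (Int.castRingHom ℚ) P := by
    intro P hP
    rw [← map_dvd_iff (MvPolynomial.finSuccEquiv ℚ r), AlgEquiv.apply_symm_apply,
      Polynomial.C_dvd_iff_dvd_coeff, finSuccEquiv_map]
    intro i
    rw [Polynomial.coeff_map]
    by_cases h0 : (MvPolynomial.finSuccEquiv ℤ r P).coeff i = 0
    · simp [h0]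
    · refine hD _ ?_
      simp only [PolyFamilies.coeffFamily, Finset.mem_biUnion]
      exact ⟨P, hP, Polynomial.coeff_mem_coeffs h0⟩
  have := hS _ hdvd
  rw [MulEquiv.isUnit_map] at this
  exact Polynomial.isUnit_C.1 this

/-- The eliminant is a polynomial combination of the members of `S`, so evaluating at `(x, n)`
modulo `p` gives the divisibility. -/
theorem UnitCommonDivisors.exists_eliminant {r : ℕ} {S : Finset (MvPolynomial (Fin (r + 1)) ℤ)}
    (hS : UnitCommonDivisors S) :
    ∃ h : MvPolynomial (Fin r) ℤ, h ≠ 0 ∧ ∀ (n : Fin r → ℤ) (x p : ℤ),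
      (∀ f ∈ S, p ∣ MvPolynomial.eval (Fin.cons x n : Fin (r + 1) → ℤ) f) →
        p ∣ MvPolynomial.eval n h := by
  obtain ⟨h, h0, hh⟩ := exists_C_mem_span
    ((MvPolynomial.finSuccEquiv ℤ r) '' (S : Set (MvPolynomial (Fin (r + 1)) ℤ))) (by
      intro D hD
      obtain ⟨E, rfl⟩ := (MvPolynomial.finSuccEquiv ℤ r).surjective D
      have hE : ∀ P ∈ S, MvPolynomial.map (Int.castRingHom ℚ) E ∣
          MvPolynomial.map (Int.castRingHom ℚ) P := fun P hP => map_dvd _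
        ((map_dvd_iff (MvPolynomial.finSuccEquiv ℤ r)).1 (hD _ ⟨P, hP, rfl⟩))
      obtain ⟨h1, h2⟩ := (isUnit_iff_rat _).1 (hS _ hE)
      constructor
      · intro h
        rw [EmbeddingLike.map_eq_zero_iff] at h
        simp [h] at h1
      · rw [MvPolynomial.totalDegree,
          MvPolynomial.support_map_of_injective _ (RingHom.injective_int _)] at h2
        rw [MvPolynomial.natDegree_finSuccEquiv]
        exact Nat.le_zero.1 ((MvPolynomial.degreeOf_le_totalDegree E 0).trans h2.le))
  refine ⟨h, h0, fun n x p hp => ?_⟩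
  have hle : Ideal.span ((MvPolynomial.finSuccEquiv ℤ r) ''
      (S : Set (MvPolynomial (Fin (r + 1)) ℤ))) ≤
      Ideal.comap ((Polynomial.evalRingHom x).comp
        (Polynomial.mapRingHom (MvPolynomial.eval n))) (Ideal.span {p}) := by
    rw [Ideal.span_le]
    rintro _ ⟨f, hf, rfl⟩
    have := hp f hf
    rw [MvPolynomial.eval_eq_eval_mv_eval'] at this
    simpa [Ideal.mem_span_singleton] using this
  have := hle hh
  simpa [Ideal.mem_span_singleton] using this

/-! ### Counting residue classes in boxes -/

/-- The box `{0, …, B - 1}^r` as a finite set. -/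
noncomputable def finBox (r B : ℕ) : Finset (Fin r → ℤ) :=
  Fintype.piFinset fun _ => Finset.Ico 0 (B : ℤ)

theorem coe_finBox (r B : ℕ) : (finBox r B : Set (Fin r → ℤ)) = box r B := by
  ext n
  simp [finBox, box]

theorem card_finBox (r B : ℕ) : (finBox r B).card = B ^ r := by
  simp [finBox]

theorem ncard_box (r B : ℕ) : (box r B).ncard = B ^ r := by
  rw [← coe_finBox, Set.ncard_coe_finset, card_finBox]

open Classical in
theorem ncard_inter_box {r : ℕ} (T : Set (Fin r → ℤ)) (B : ℕ) :
    (T ∩ box r B).ncard = ((finBox r B).filter (· ∈ T)).card := by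
  rw [← Set.ncard_coe_finset, Finset.coe_filter, ← coe_finBox]
  congr 1
  ext n
  simp [and_comm]

open Classical in
theorem card_filter_finBox_succ (r B : ℕ) (q : (Fin (r + 1) → ℤ) → Prop) :
    ((finBox (r + 1) B).filter q).card = ∑ n ∈ finBox r B,
      ((Finset.Ico 0 (B : ℤ)).filter fun x => q (Fin.cons x n)).card := by
  rw [Finset.card_eq_sum_card_fiberwise (f := Fin.tail) (t := (finBox r B : Finset (Fin r → ℤ)))]
  · refine Finset.sum_congr rfl fun n hn => ?_
    refine Finset.card_nbij' (fun m => m 0) (fun x => Fin.cons x n) ?_ ?_ ?_ ?_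
    · intro m hm
      simp only [finBox, Finset.coe_filter, Finset.mem_filter, Fintype.mem_piFinset,
        Set.mem_ofPred_eq] at hm ⊢
      obtain ⟨⟨h1, h2⟩, rfl⟩ := hm
      exact ⟨h1 0, by rwa [Fin.cons_self_tail]⟩
    · intro x hx
      simp only [finBox, Finset.coe_filter, Finset.mem_filter, Fintype.mem_piFinset,
        Set.mem_ofPred_eq] at hx hn ⊢
      refine ⟨⟨fun i => ?_, hx.2⟩, Fin.tail_cons _ _⟩
      refine Fin.cases ?_ (fun j => ?_) i
      · simpa using hx.1
      · simpa using hn j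
    · intro m hm
      simp only [Finset.coe_filter, Finset.mem_filter, Set.mem_ofPred_eq] at hm
      obtain ⟨_, rfl⟩ := hm
      exact Fin.cons_self_tail m
    · intro x hx
      rfl
  · intro m hm
    simp only [finBox, Finset.coe_filter, Fintype.mem_piFinset,
        Set.mem_ofPred_eq, Finset.mem_coe] at hm ⊢
    exact fun i => hm.1 i.succ

theorem abs_card_residue_sub_le (N : ℕ) [NeZero N] (a : ZMod N) (B : ℕ) :
    |(((Finset.Ico 0 (B : ℤ)).filter fun x : ℤ => (x : ZMod N) = a).card : ℝ) - (B : ℝ) / N| ≤ 1 := by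
  have hN : 0 < (N : ℤ) := by exact_mod_cast Nat.pos_of_ne_zero (NeZero.ne N)
  have h := Int.Ico_filter_modEq_card 0 (B : ℤ) hN a.val
  have hset : ((Finset.Ico 0 (B : ℤ)).filter fun x : ℤ => (x : ZMod N) = a) =
      (Finset.Ico 0 (B : ℤ)).filter fun x => x ≡ a.val [ZMOD N] := by
    refine Finset.filter_congr fun x _ => ?_
    rw [← ZMod.intCast_eq_intCast_iff]
    simp
  rw [← hset] at h
  set c := ((Finset.Ico 0 (B : ℤ)).filter fun x : ℤ => (x : ZMod N) = a).card
  set u : ℚ := ((B : ℤ) - (a.val : ℤ) : ℚ) / ((N : ℤ) : ℚ) with hu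
  set v : ℚ := ((0 : ℤ) - (a.val : ℤ) : ℚ) / ((N : ℤ) : ℚ) with hv
  have huv : u = v + (B : ℚ) / N := by
    rw [hu, hv]; push_cast; ring
  have hB : (0 : ℚ) ≤ (B : ℚ) / N := by positivity
  have hmono : ⌈v⌉ ≤ ⌈u⌉ := Int.ceil_mono (by linarith)
  rw [max_eq_left (by linarith)] at h
  have hc : (c : ℚ) = ⌈u⌉ - ⌈v⌉ := by exact_mod_cast h
  have hq : |(c : ℚ) - (B : ℚ) / N| ≤ 1 := by
    have h1 := Int.le_ceil u
    have h2 := Int.ceil_lt_add_one u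
    have h3 := Int.le_ceil v
    have h4 := Int.ceil_lt_add_one v
    rw [abs_le]
    constructor <;> linarith
  have hr := (Rat.cast_le (K := ℝ)).2 hq
  push_cast at hr
  exact hr

theorem card_residue_le (N : ℕ) [NeZero N] (a : ZMod N) (B : ℕ) :
    (((Finset.Ico 0 (B : ℤ)).filter fun x : ℤ => (x : ZMod N) = a).card : ℝ) ≤ (B : ℝ) / N + 1 := by
  have := (abs_le.1 (abs_card_residue_sub_le N a B)).2
  linarith

theorem tendsto_card_residue (N : ℕ) [NeZero N] (a : ZMod N) :
    Tendsto (fun B : ℕ =>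
      (((Finset.Ico 0 (B : ℤ)).filter fun x : ℤ => (x : ZMod N) = a).card : ℝ) / B) atTop
      (𝓝 (1 / (N : ℝ))) := by
  rw [tendsto_iff_norm_sub_tendsto_zero]
  refine squeeze_zero' (Eventually.of_forall fun _ => norm_nonneg _) ?_
    tendsto_one_div_atTop_nhds_zero_nat
  filter_upwards [eventually_gt_atTop 0] with B hB
  have hB' : (0 : ℝ) < B := by exact_mod_cast hB
  have h := abs_card_residue_sub_le N a B
  set c := (((Finset.Ico 0 (B : ℤ)).filter fun x : ℤ => (x : ZMod N) = a).card : ℝ)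
  have : c / B - 1 / (N : ℝ) = (c - B / N) / B := by
    field_simp
  rw [this, Real.norm_eq_abs, abs_div, abs_of_pos hB']
  gcongr

theorem finBox_filter_residue (r N B : ℕ) (w : Fin r → ZMod N) :
    ((finBox r B).filter fun n => (fun i => (n i : ZMod N)) = w) =
      Fintype.piFinset fun i => (Finset.Ico 0 (B : ℤ)).filter fun x : ℤ => (x : ZMod N) = w i := by
  ext n
  simp only [finBox, Finset.mem_filter, Fintype.mem_piFinset, funext_iff]
  exact forall_and.symm

open Classical in
theorem card_filter_residues (r N B : ℕ) (W : Finset (Fin r → ZMod N)) :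
    ((finBox r B).filter fun n => (fun i => (n i : ZMod N)) ∈ W).card =
      ∑ w ∈ W, ∏ i, ((Finset.Ico 0 (B : ℤ)).filter fun x : ℤ => (x : ZMod N) = w i).card := by
  rw [Finset.card_eq_sum_card_fiberwise (f := fun n : Fin r → ℤ => fun i => (n i : ZMod N))
    (t := W)]
  · refine Finset.sum_congr rfl fun w hw => ?_
    rw [← Fintype.card_piFinset, ← finBox_filter_residue, Finset.filter_filter]
    congr 1
    refine Finset.filter_congr fun n _ => ?_
    constructor
    · exact fun h => h.2
    · exact fun h => ⟨h ▸ hw, h⟩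
  · intro n hn
    simpa using (Finset.mem_filter.1 hn).2

open Classical in
theorem card_filter_residues_le (r N B : ℕ) [NeZero N] (W : Finset (Fin r → ZMod N)) :
    (((finBox r B).filter fun n => (fun i => (n i : ZMod N)) ∈ W).card : ℝ) ≤
      W.card * ((B : ℝ) / N + 1) ^ r := by
  rw [card_filter_residues]
  push_cast
  calc _ ≤ ∑ w ∈ W, ((B : ℝ) / N + 1) ^ r := by
        refine Finset.sum_le_sum fun w _ => ?_
        calc _ ≤ ∏ i : Fin r, ((B : ℝ) / N + 1) :=
              Finset.prod_le_prod (fun _ _ => Nat.cast_nonneg _) fun i _ => card_residue_le N (w i) B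
          _ = ((B : ℝ) / N + 1) ^ r := by simp
    _ = _ := by simp

open Classical in
theorem tendsto_card_filter_residues (r N : ℕ) [NeZero N] (W : Finset (Fin r → ZMod N)) :
    Tendsto (fun B : ℕ =>
      (((finBox r B).filter fun n => (fun i => (n i : ZMod N)) ∈ W).card : ℝ) / (B : ℝ) ^ r) atTop
      (𝓝 (W.card / (N : ℝ) ^ r)) := by
  have h : Tendsto (fun B : ℕ => ∑ w ∈ W, ∏ i : Fin r,
      (((Finset.Ico 0 (B : ℤ)).filter fun x : ℤ => (x : ZMod N) = w i).card : ℝ) / B) atTop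
      (𝓝 (∑ w ∈ W, ∏ i : Fin r, 1 / (N : ℝ))) :=
    tendsto_finsetSum _ fun w _ => tendsto_finsetProd _ fun i _ => tendsto_card_residue N (w i)
  have hlim : (∑ w ∈ W, ∏ i : Fin r, 1 / (N : ℝ)) = W.card / (N : ℝ) ^ r := by
    simp [div_eq_mul_inv]
  rw [hlim] at h
  refine h.congr fun B => ?_
  rw [card_filter_residues]
  simp [Finset.prod_div_distrib, Finset.sum_div]

/-! ### Values and zeros of one polynomial on a box -/

theorem eval_map_intCast {r : ℕ} (N : ℕ) (n : Fin r → ℤ) (Q : MvPolynomial (Fin r) ℤ) :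
    MvPolynomial.eval (fun i => (n i : ZMod N)) (MvPolynomial.map (Int.castRingHom (ZMod N)) Q) =
      ((MvPolynomial.eval n Q : ℤ) : ZMod N) := by
  induction Q using MvPolynomial.induction_on <;> simp_all

theorem exists_abs_eval_le {r : ℕ} (h : MvPolynomial (Fin r) ℤ) :
    ∃ C e : ℕ, ∀ B : ℕ, 1 ≤ B → ∀ n ∈ finBox r B, (MvPolynomial.eval n h).natAbs ≤ C * B ^ e := by
  induction h using MvPolynomial.induction_on with
  | C a => exact ⟨a.natAbs, 0, fun B _ n _ => by simp⟩
  | add p q hp hq =>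
    obtain ⟨C, e, h1⟩ := hp
    obtain ⟨C', e', h2⟩ := hq
    refine ⟨C + C', max e e', fun B hB n hn => ?_⟩
    rw [map_add]
    calc _ ≤ _ := Int.natAbs_add_le _ _
      _ ≤ C * B ^ e + C' * B ^ e' := add_le_add (h1 B hB n hn) (h2 B hB n hn)
      _ ≤ C * B ^ (max e e') + C' * B ^ (max e e') := by
        gcongr
        · exact le_max_left _ _
        · exact le_max_right _ _
      _ = _ := by ring
  | mul_X p i hp =>
    obtain ⟨C, e, h1⟩ := hp
    refine ⟨C, e + 1, fun B hB n hn => ?_⟩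
    rw [map_mul, MvPolynomial.eval_X, Int.natAbs_mul, pow_succ, ← mul_assoc]
    refine Nat.mul_le_mul (h1 B hB n hn) ?_
    have := (Fintype.mem_piFinset.1 hn) i
    rw [Finset.mem_Ico] at this
    omega

/-- Each nonzero value of a polynomial on a box of side `B` has boundedly many prime divisors greater
than `B`. -/
theorem exists_card_large_primes_le {r : ℕ} (h : MvPolynomial (Fin r) ℤ) :
    ∃ e : ℕ, ∀ᶠ B : ℕ in atTop, ∀ n ∈ finBox r B, MvPolynomial.eval n h ≠ 0 →
      ((MvPolynomial.eval n h).natAbs.primeFactors.filter (B < ·)).card ≤ e := by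
  obtain ⟨C, e, hC⟩ := exists_abs_eval_le h
  refine ⟨e, ?_⟩
  -- This gives both `C < B`, so that values are below `B ^ (e + 1)`, and `1 < B`, so that exponents
  -- can be compared.
  filter_upwards [eventually_gt_atTop (C + 1)] with B hB n hn h0
  set s := (MvPolynomial.eval n h).natAbs.primeFactors.filter (B < ·)
  have hdvd : ∏ p ∈ s, p ∣ (MvPolynomial.eval n h).natAbs :=
    Finset.prod_primes_dvd _ (fun p hp => (Nat.prime_of_mem_primeFactors
      (Finset.mem_filter.1 hp).1).prime) fun p hp => Nat.dvd_of_mem_primeFactors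
      (Finset.mem_filter.1 hp).1
  have h1 : B ^ s.card ≤ ∏ p ∈ s, p :=
    Finset.pow_card_le_prod _ _ _ fun p hp => (Finset.mem_filter.1 hp).2.le
  have h2 : B ^ s.card < B ^ (e + 1) := by
    calc _ ≤ C * B ^ e := h1.trans ((Nat.le_of_dvd (Int.natAbs_pos.2 h0) hdvd).trans
            (hC B (by omega) n hn))
      _ < B * B ^ e := Nat.mul_lt_mul_of_pos_right (by omega) (pow_pos (by omega) _)
      _ = _ := by ring
  exact Nat.lt_succ_iff.1 ((Nat.pow_lt_pow_iff_right (by omega)).1 h2)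

theorem card_zeros_finBox_le {r : ℕ} {h : MvPolynomial (Fin r) ℤ} (h0 : h ≠ 0) {B : ℕ}
    (hB : 0 < B) :
    (((finBox r B).filter fun n => MvPolynomial.eval n h = 0).card : ℝ) ≤
      h.totalDegree * (B : ℝ) ^ r / B := by
  have := MvPolynomial.schwartz_zippel_totalDegree h0 (Finset.Ico 0 (B : ℤ))
  rw [Int.card_Ico, sub_zero, Int.toNat_natCast, div_le_iff₀ (by positivity)] at this
  have h2 : (((finBox r B).filter fun n => MvPolynomial.eval n h = 0).card : ℝ) ≤
      h.totalDegree / B * (B : ℝ) ^ r := by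
    have h3 := (NNRat.cast_le (K := ℝ)).2 this
    push_cast at h3
    exact h3
  calc _ ≤ _ := h2
    _ = _ := by ring

-- Schwartz–Zippel over `ZMod p` bounds the number of zero classes, and each class has at most `(B /
-- p + 1) ^ r` points in the box.
open Classical in
theorem card_dvd_finBox_le {r : ℕ} (h : MvPolynomial (Fin r) ℤ) {p : ℕ} (hp : p.Prime)
    (h0 : MvPolynomial.map (Int.castRingHom (ZMod p)) h ≠ 0) (B : ℕ) :
    (((finBox r B).filter fun n => (p : ℤ) ∣ MvPolynomial.eval n h).card : ℝ) ≤
      h.totalDegree / p * (p : ℝ) ^ r * ((B : ℝ) / p + 1) ^ r := by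
  have := Fact.mk hp
  set W : Finset (Fin r → ZMod p) := Finset.univ.filter fun n =>
    MvPolynomial.eval n (MvPolynomial.map (Int.castRingHom (ZMod p)) h) = 0 with hW
  have hWc : (W.card : ℝ) ≤ h.totalDegree / p * (p : ℝ) ^ r := by
    have := MvPolynomial.schwartz_zippel_totalDegree h0 (Finset.univ : Finset (ZMod p))
    rw [Finset.card_univ, ZMod.card, div_le_iff₀ (by have := hp.pos; positivity),
      Fintype.piFinset_univ] at this
    have h2 : (W.card : ℝ) ≤
        (MvPolynomial.map (Int.castRingHom (ZMod p)) h).totalDegree / p * (p : ℝ) ^ r := by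
      have h3 := (NNRat.cast_le (K := ℝ)).2 this
      push_cast at h3
      exact h3
    refine h2.trans ?_
    gcongr
    exact Finset.sup_mono (MvPolynomial.support_map_subset _ _)
  have hset : ((finBox r B).filter fun n => (p : ℤ) ∣ MvPolynomial.eval n h) =
      (finBox r B).filter fun n => (fun i => (n i : ZMod p)) ∈ W := by
    refine Finset.filter_congr fun n _ => ?_
    rw [hW, Finset.mem_filter, ← ZMod.intCast_zmod_eq_zero_iff_dvd, eval_map_intCast]
    simp
  rw [hset]
  refine (card_filter_residues_le r p B W).trans ?_
  gcongr

/-! ### Ekedahl's sieve for large primes -/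

/-- The points at which all members of `S` are divisible by a common prime greater than `M`. -/
def largePrimeSet {r : ℕ} (S : Finset (MvPolynomial (Fin r) ℤ)) (M : ℕ) : Set (Fin r → ℤ) :=
  {n | ∃ p : ℕ, p.Prime ∧ M < p ∧ ∀ f ∈ S, (p : ℤ) ∣ MvPolynomial.eval n f}

-- Some coefficient in `x₀` is nonzero mod `p` at `n`, so one member restricts to a nonzero
-- polynomial over `ZMod p`, with at most `d` roots.
open Classical in
theorem card_fiber_le {r : ℕ} {S : Finset (MvPolynomial (Fin (r + 1)) ℤ)} {d : ℕ}
    (hd : ∀ f ∈ S, (MvPolynomial.finSuccEquiv ℤ r f).natDegree ≤ d) {p : ℕ} (hp : p.Prime)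
    {n : Fin r → ℤ} (hn : ¬ ∀ g ∈ coeffFamily S, (p : ℤ) ∣ MvPolynomial.eval n g) (B : ℕ) :
    (((Finset.Ico 0 (B : ℤ)).filter fun x => ∀ f ∈ S,
      (p : ℤ) ∣ MvPolynomial.eval (Fin.cons x n : Fin (r + 1) → ℤ) f).card : ℝ) ≤
      d * ((B : ℝ) / p + 1) := by
  have := Fact.mk hp
  push Not at hn
  obtain ⟨g, hg, hgp⟩ := hn
  simp only [coeffFamily, Finset.mem_biUnion, Polynomial.mem_coeffs_iff] at hg
  obtain ⟨f, hf, i, hi, rfl⟩ := hg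
  set G : Polynomial (ZMod p) := (MvPolynomial.finSuccEquiv ℤ r f).map
    ((Int.castRingHom (ZMod p)).comp (MvPolynomial.eval n)) with hG
  have hG0 : G ≠ 0 := by
    intro h
    have hc : G.coeff i = 0 := by rw [h, Polynomial.coeff_zero]
    rw [hG, Polynomial.coeff_map, RingHom.comp_apply, Int.coe_castRingHom,
      ZMod.intCast_zmod_eq_zero_iff_dvd] at hc
    exact hgp hc
  have hsub : ((Finset.Ico 0 (B : ℤ)).filter fun x => ∀ f ∈ S,
      (p : ℤ) ∣ MvPolynomial.eval (Fin.cons x n : Fin (r + 1) → ℤ) f) ⊆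
      G.roots.toFinset.biUnion fun a =>
        (Finset.Ico 0 (B : ℤ)).filter fun x : ℤ => (x : ZMod p) = a := by
    intro x hx
    rw [Finset.mem_filter] at hx
    simp only [Finset.mem_biUnion, Finset.mem_filter, Multiset.mem_toFinset]
    refine ⟨x, ?_, hx.1, rfl⟩
    rw [Polynomial.mem_roots hG0, Polynomial.IsRoot.def]
    have h1 := hx.2 f hf
    rw [MvPolynomial.eval_eq_eval_mv_eval', ← ZMod.intCast_zmod_eq_zero_iff_dvd] at h1
    rw [hG, ← Polynomial.map_map, Polynomial.eval_intCast_map]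
    exact h1
  have hcard : (G.roots.toFinset.card : ℝ) ≤ d := by
    exact_mod_cast (Multiset.toFinset_card_le _).trans ((Polynomial.card_roots' G).trans
      (Polynomial.natDegree_map_le.trans (hd f hf)))
  calc _ ≤ ((G.roots.toFinset.biUnion fun a =>
        (Finset.Ico 0 (B : ℤ)).filter fun x : ℤ => (x : ZMod p) = a).card : ℝ) := by
          exact_mod_cast Finset.card_le_card hsub
    _ ≤ ∑ a ∈ G.roots.toFinset,
        (((Finset.Ico 0 (B : ℤ)).filter fun x : ℤ => (x : ZMod p) = a).card : ℝ) := by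
          exact_mod_cast Finset.card_biUnion_le
    _ ≤ ∑ a ∈ G.roots.toFinset, ((B : ℝ) / p + 1) :=
          Finset.sum_le_sum fun a _ => card_residue_le p a B
    _ = G.roots.toFinset.card * ((B : ℝ) / p + 1) := by rw [Finset.sum_const, nsmul_eq_mul]
    _ ≤ _ := by gcongr

open Classical in
/-- The fiber of `largePrimeSet S M` over a point `n` at which neither the coefficient family has a
large common prime divisor nor the eliminant `h` vanishes. -/
theorem card_fiber_largePrimeSet_le {r : ℕ} {S : Finset (MvPolynomial (Fin (r + 1)) ℤ)} {d M : ℕ}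
    (hd : ∀ f ∈ S, (MvPolynomial.finSuccEquiv ℤ r f).natDegree ≤ d)
    {h : MvPolynomial (Fin r) ℤ} (hh : ∀ (n : Fin r → ℤ) (x p : ℤ),
      (∀ f ∈ S, p ∣ MvPolynomial.eval (Fin.cons x n : Fin (r + 1) → ℤ) f) →
        p ∣ MvPolynomial.eval n h)
    {n : Fin r → ℤ} (hn : n ∉ largePrimeSet (coeffFamily S) M)
    (hn0 : MvPolynomial.eval n h ≠ 0) (B : ℕ) :
    (((Finset.Ico 0 (B : ℤ)).filter fun x =>
      (Fin.cons x n : Fin (r + 1) → ℤ) ∈ largePrimeSet S M).card : ℝ) ≤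
      2 * d * ((MvPolynomial.eval n h).natAbs.primeFactors.filter (B < ·)).card +
      ∑ p ∈ (Finset.Ioc M B).filter Nat.Prime,
        2 * d * ((B : ℝ) / p) * (if (p : ℤ) ∣ MvPolynomial.eval n h then 1 else 0) := by
  set s := (MvPolynomial.eval n h).natAbs.primeFactors.filter (B < ·)
  set t := ((Finset.Ioc M B).filter Nat.Prime).filter fun p : ℕ =>
    (p : ℤ) ∣ MvPolynomial.eval n h with ht
  set c : ℕ → Finset ℤ := fun p => (Finset.Ico 0 (B : ℤ)).filter fun x => ∀ f ∈ S,
    (p : ℤ) ∣ MvPolynomial.eval (Fin.cons x n : Fin (r + 1) → ℤ) f with hc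
  have hsub : ((Finset.Ico 0 (B : ℤ)).filter fun x =>
      (Fin.cons x n : Fin (r + 1) → ℤ) ∈ largePrimeSet S M) ⊆
      (s.filter (M < ·)).biUnion c ∪ t.biUnion c := by
    intro x hx
    rw [Finset.mem_filter] at hx
    obtain ⟨hxB, p, hp, hMp, hpf⟩ := hx
    have hph := hh n x p hpf
    have hxc : x ∈ c p := Finset.mem_filter.2 ⟨hxB, hpf⟩
    rw [Finset.mem_union, Finset.mem_biUnion, Finset.mem_biUnion]
    -- Up to `B`, the bound `B / p + 1` is at most `2 * (B / p)`; beyond `B` it is at most 2.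
    by_cases hpB : B < p
    · refine Or.inl ⟨p, ?_, hxc⟩
      refine Finset.mem_filter.2 ⟨Finset.mem_filter.2 ⟨?_, hpB⟩, hMp⟩
      exact Nat.mem_primeFactors.2 ⟨hp, Int.natCast_dvd.1 hph, Int.natAbs_ne_zero.2 hn0⟩
    · refine Or.inr ⟨p, ?_, hxc⟩
      refine Finset.mem_filter.2 ⟨Finset.mem_filter.2 ⟨?_, hp⟩, hph⟩
      exact Finset.mem_Ioc.2 ⟨hMp, not_lt.1 hpB⟩
  have hcp : ∀ p : ℕ, p.Prime → M < p → ((c p).card : ℝ) ≤ d * ((B : ℝ) / p + 1) :=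
    fun p hp hMp => card_fiber_le hd hp (fun hall => hn ⟨p, hp, hMp, hall⟩) B
  have h1 : (((s.filter (M < ·)).biUnion c).card : ℝ) ≤ 2 * d * s.card := by
    calc _ ≤ ∑ p ∈ s.filter (M < ·), ((c p).card : ℝ) := by exact_mod_cast Finset.card_biUnion_le
      _ ≤ ∑ p ∈ s.filter (M < ·), (2 * d : ℝ) := by
        refine Finset.sum_le_sum fun p hp => ?_
        obtain ⟨hps, hMp⟩ := Finset.mem_filter.1 hp
        obtain ⟨hpf, hBp⟩ := Finset.mem_filter.1 hps
        have hpp := Nat.prime_of_mem_primeFactors hpf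
        refine (hcp p hpp hMp).trans ?_
        have : (B : ℝ) / p ≤ 1 := by
          rw [div_le_one (by exact_mod_cast hpp.pos)]
          exact_mod_cast hBp.le
        nlinarith [(Nat.cast_nonneg d : (0 : ℝ) ≤ d)]
      _ = 2 * d * ((s.filter (M < ·)).card : ℝ) := by rw [Finset.sum_const, nsmul_eq_mul]; ring
      _ ≤ _ := by
        gcongr
        exact Finset.filter_subset _ _
  have h2 : ((t.biUnion c).card : ℝ) ≤ ∑ p ∈ (Finset.Ioc M B).filter Nat.Prime,
      2 * d * ((B : ℝ) / p) * (if (p : ℤ) ∣ MvPolynomial.eval n h then 1 else 0) := by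
    calc _ ≤ ∑ p ∈ t, ((c p).card : ℝ) := by exact_mod_cast Finset.card_biUnion_le
      _ ≤ ∑ p ∈ t, 2 * d * ((B : ℝ) / p) := by
        refine Finset.sum_le_sum fun p hp => ?_
        obtain ⟨hps, -⟩ := Finset.mem_filter.1 hp
        obtain ⟨hI, hpp⟩ := Finset.mem_filter.1 hps
        obtain ⟨hMp, hpB⟩ := Finset.mem_Ioc.1 hI
        refine (hcp p hpp hMp).trans ?_
        have : 1 ≤ (B : ℝ) / p := by
          rw [one_le_div (by exact_mod_cast hpp.pos)]
          exact_mod_cast hpB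
        nlinarith [(Nat.cast_nonneg d : (0 : ℝ) ≤ d)]
      _ = _ := by
        rw [ht, Finset.sum_filter]
        refine Finset.sum_congr rfl fun p _ => ?_
        split_ifs <;> simp
  calc _ ≤ (((s.filter (M < ·)).biUnion c ∪ t.biUnion c).card : ℝ) := by
        exact_mod_cast Finset.card_le_card hsub
    _ ≤ ((s.filter (M < ·)).biUnion c).card + (t.biUnion c).card := by
        exact_mod_cast Finset.card_union_le _ _
    _ ≤ _ := add_le_add h1 h2

open Classical in
/-- The medium primes `M < p ≤ B` contribute at most a small multiple of `B ^ (r + 1)`. -/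
theorem sum_medium_primes_le {r : ℕ} {h : MvPolynomial (Fin r) ℤ} {M : ℕ}
    (hM : ∀ p : ℕ, p.Prime → M < p → MvPolynomial.map (Int.castRingHom (ZMod p)) h ≠ 0)
    (d B : ℕ) :
    ∑ n ∈ finBox r B, ∑ p ∈ (Finset.Ioc M B).filter Nat.Prime,
        2 * d * ((B : ℝ) / p) * (if (p : ℤ) ∣ MvPolynomial.eval n h then 1 else 0) ≤
      (2 * d * h.totalDegree * 2 ^ r : ℝ) * (2 / (M + 1)) * (B : ℝ) ^ (r + 1) := by
  rw [Finset.sum_comm]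
  -- One factor `1 / p` comes from the roots in the fiber, the other from the density of `p ∣ h(n)`.
  calc _ ≤ ∑ p ∈ (Finset.Ioc M B).filter Nat.Prime,
        (2 * d * h.totalDegree * 2 ^ r : ℝ) * (B : ℝ) ^ (r + 1) * ((p : ℝ) ^ 2)⁻¹ := by
        refine Finset.sum_le_sum fun p hp => ?_
        obtain ⟨hI, hpp⟩ := Finset.mem_filter.1 hp
        obtain ⟨hMp, hpB⟩ := Finset.mem_Ioc.1 hI
        have hp0 : (0 : ℝ) < p := by exact_mod_cast hpp.pos
        have hBp : 1 ≤ (B : ℝ) / p := by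
          rw [one_le_div hp0]
          exact_mod_cast hpB
        rw [← Finset.mul_sum, Finset.sum_boole]
        calc _ ≤ 2 * d * ((B : ℝ) / p) *
              (h.totalDegree / p * (p : ℝ) ^ r * (2 * ((B : ℝ) / p)) ^ r) := by
              gcongr
              refine (card_dvd_finBox_le h hpp (hM p hpp hMp) B).trans ?_
              gcongr
              linarith
          _ = _ := by
              rw [mul_pow, div_pow, pow_succ]
              field_simp
    _ ≤ ∑ p ∈ Finset.Ioo M (B + 1),
        (2 * d * h.totalDegree * 2 ^ r : ℝ) * (B : ℝ) ^ (r + 1) * ((p : ℝ) ^ 2)⁻¹ := by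
        refine Finset.sum_le_sum_of_subset_of_nonneg ?_ fun _ _ _ => by positivity
        intro p hp
        have := Finset.mem_Ioc.1 (Finset.mem_filter.1 hp).1
        rw [Finset.mem_Ioo]
        omega
    _ ≤ (2 * d * h.totalDegree * 2 ^ r : ℝ) * (B : ℝ) ^ (r + 1) * (2 / (M + 1)) := by
        rw [← Finset.mul_sum]
        gcongr
        exact sum_Ioo_inv_sq_le M (B + 1)
    _ = _ := by ring

open Classical in
theorem card_largePrimeSet_succ_le {r : ℕ} {S : Finset (MvPolynomial (Fin (r + 1)) ℤ)}
    {d e M B : ℕ} (hB : 0 < B)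
    (hd : ∀ f ∈ S, (MvPolynomial.finSuccEquiv ℤ r f).natDegree ≤ d)
    {h : MvPolynomial (Fin r) ℤ} (h0 : h ≠ 0) (hh : ∀ (n : Fin r → ℤ) (x p : ℤ),
      (∀ f ∈ S, p ∣ MvPolynomial.eval (Fin.cons x n : Fin (r + 1) → ℤ) f) →
        p ∣ MvPolynomial.eval n h)
    (hM : ∀ p : ℕ, p.Prime → M < p → MvPolynomial.map (Int.castRingHom (ZMod p)) h ≠ 0)
    (he : ∀ n ∈ finBox r B, MvPolynomial.eval n h ≠ 0 →
      ((MvPolynomial.eval n h).natAbs.primeFactors.filter (B < ·)).card ≤ e) :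
    (((finBox (r + 1) B).filter (· ∈ largePrimeSet S M)).card : ℝ) ≤
      B * ((finBox r B).filter (· ∈ largePrimeSet (coeffFamily S) M)).card +
      (h.totalDegree + 2 * d * e) * (B : ℝ) ^ r +
      (2 * d * h.totalDegree * 2 ^ r : ℝ) * (2 / (M + 1)) * (B : ℝ) ^ (r + 1) := by
  have hB' : (0 : ℝ) < B := by exact_mod_cast hB
  rw [card_filter_finBox_succ]
  push_cast
  have hfib : ∀ n ∈ finBox r B, (((Finset.Ico 0 (B : ℤ)).filter fun x =>
      (Fin.cons x n : Fin (r + 1) → ℤ) ∈ largePrimeSet S M).card : ℝ) ≤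
      B * (if n ∈ largePrimeSet (coeffFamily S) M then 1 else 0) +
      B * (if MvPolynomial.eval n h = 0 then 1 else 0) + 2 * d * e +
      ∑ p ∈ (Finset.Ioc M B).filter Nat.Prime,
        2 * d * ((B : ℝ) / p) * (if (p : ℤ) ∣ MvPolynomial.eval n h then 1 else 0) := by
    intro n hn
    have hle : (((Finset.Ico 0 (B : ℤ)).filter fun x =>
        (Fin.cons x n : Fin (r + 1) → ℤ) ∈ largePrimeSet S M).card : ℝ) ≤ B := by
      have := Finset.card_filter_le (Finset.Ico 0 (B : ℤ))
        fun x => (Fin.cons x n : Fin (r + 1) → ℤ) ∈ largePrimeSet S M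
      rw [Int.card_Ico, sub_zero, Int.toNat_natCast] at this
      exact_mod_cast this
    have hsum : (0 : ℝ) ≤ ∑ p ∈ (Finset.Ioc M B).filter Nat.Prime,
        2 * d * ((B : ℝ) / p) * (if (p : ℤ) ∣ MvPolynomial.eval n h then 1 else 0) := by
      refine Finset.sum_nonneg fun p _ => ?_
      split_ifs <;> positivity
    have hde : (0 : ℝ) ≤ 2 * d * e := by positivity
    by_cases h1 : n ∈ largePrimeSet (coeffFamily S) M
    · rw [if_pos h1]
      have : (0 : ℝ) ≤ B * (if MvPolynomial.eval n h = 0 then 1 else 0) := by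
        split_ifs <;> simp
      linarith
    by_cases h2 : MvPolynomial.eval n h = 0
    · rw [if_neg h1, if_pos h2]
      linarith
    rw [if_neg h1, if_neg h2]
    refine (card_fiber_largePrimeSet_le hd hh h1 h2 B).trans ?_
    have h3 : (((MvPolynomial.eval n h).natAbs.primeFactors.filter (B < ·)).card : ℝ) ≤ e := by
      exact_mod_cast he n hn h2
    have h4 : (2 * d : ℝ) * ((MvPolynomial.eval n h).natAbs.primeFactors.filter (B < ·)).card ≤
        2 * d * e := by gcongr
    linarith
  refine (Finset.sum_le_sum hfib).trans ?_
  rw [Finset.sum_add_distrib, Finset.sum_add_distrib, Finset.sum_add_distrib, ← Finset.mul_sum,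
    ← Finset.mul_sum, Finset.sum_boole, Finset.sum_boole, Finset.sum_const, card_finBox,
    nsmul_eq_mul]
  have hz := card_zeros_finBox_le h0 hB
  have hz' : (B : ℝ) * ((finBox r B).filter fun n => MvPolynomial.eval n h = 0).card ≤
      h.totalDegree * (B : ℝ) ^ r := by
    calc _ ≤ (B : ℝ) * (h.totalDegree * (B : ℝ) ^ r / B) := by gcongr
      _ = _ := by field_simp
  have hs := sum_medium_primes_le hM d B
  push_cast
  linarith

theorem exists_forall_map_ne_zero {r : ℕ} {h : MvPolynomial (Fin r) ℤ} (h0 : h ≠ 0) :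
    ∃ M : ℕ, ∀ p : ℕ, p.Prime → M < p →
      MvPolynomial.map (Int.castRingHom (ZMod p)) h ≠ 0 := by
  obtain ⟨m, hm⟩ := MvPolynomial.ne_zero_iff.1 h0
  refine ⟨(h.coeff m).natAbs, fun p _ hMp hp0 => ?_⟩
  have : MvPolynomial.coeff m (MvPolynomial.map (Int.castRingHom (ZMod p)) h) = 0 := by
    rw [hp0, MvPolynomial.coeff_zero]
  rw [MvPolynomial.coeff_map, Int.coe_castRingHom, ZMod.intCast_zmod_eq_zero_iff_dvd] at this
  have h2 := Nat.le_of_dvd (Int.natAbs_pos.2 hm) (Int.natCast_dvd.1 this)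
  omega

theorem largePrimeSet_anti {r : ℕ} (S : Finset (MvPolynomial (Fin r) ℤ)) {M M' : ℕ}
    (hM : M ≤ M') : largePrimeSet S M' ⊆ largePrimeSet S M :=
  fun _ ⟨p, hp, hMp, h⟩ => ⟨p, hp, hM.trans_lt hMp, h⟩

open Classical in
/-- **Ekedahl's sieve.** For a coprime family, the points at which a large prime divides all values
have small upper density. -/
theorem UnitCommonDivisors.exists_card_largePrimeSet_le {r : ℕ} :
    ∀ {S : Finset (MvPolynomial (Fin r) ℤ)}, UnitCommonDivisors S → ∀ {η : ℝ}, 0 < η →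
      ∃ M : ℕ, ∀ᶠ B : ℕ in atTop,
        (((finBox r B).filter (· ∈ largePrimeSet S M)).card : ℝ) ≤ η * (B : ℝ) ^ r := by
  induction r with
  | zero =>
    intro S hS η hη
    obtain ⟨f, hf, hf0⟩ : ∃ f ∈ S, f ≠ 0 := by
      by_contra! hall
      refine not_isUnit_zero (hS 0 fun P hP => ?_)
      simp [hall P hP]
    obtain ⟨c, rfl⟩ := MvPolynomial.C_surjective (Fin 0) f
    have hc : c ≠ 0 := by
      rintro rfl
      simp at hf0
    refine ⟨c.natAbs, Eventually.of_forall fun B => ?_⟩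
    rw [Finset.filter_false_of_mem]
    · simpa using hη.le
    · rintro n - ⟨p, hp, hMp, hall⟩
      have := hall _ hf
      rw [MvPolynomial.eval_C] at this
      have h2 := Nat.le_of_dvd (Int.natAbs_pos.2 hc) (Int.natCast_dvd.1 this)
      omega
  | succ r ih =>
    intro S hS η hη
    obtain ⟨M₁, hM₁⟩ := ih hS.coeffFamily (η := η / 3) (by positivity)
    obtain ⟨h, h0, hh⟩ := hS.exists_eliminant
    obtain ⟨M₂, hM₂⟩ := exists_forall_map_ne_zero h0
    obtain ⟨e, he⟩ := exists_card_large_primes_le h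
    set d := S.sup fun f => (MvPolynomial.finSuccEquiv ℤ r f).natDegree
    have hd : ∀ f ∈ S, (MvPolynomial.finSuccEquiv ℤ r f).natDegree ≤ d := fun f hf =>
      Finset.le_sup (f := fun f => (MvPolynomial.finSuccEquiv ℤ r f).natDegree) hf
    set K : ℝ := 2 * d * h.totalDegree * 2 ^ r with hK
    have hK0 : 0 ≤ K := by positivity
    -- `M₃` makes the medium-prime term, and `B₀` the term of order `B ^ r`, at most a third of the
    -- allowance; the induction hypothesis takes the last third.
    obtain ⟨M₃, hM₃⟩ := exists_nat_gt (6 * K / η)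
    obtain ⟨B₀, hB₀⟩ := exists_nat_gt (3 * (h.totalDegree + 2 * d * e : ℝ) / η)
    refine ⟨max M₁ (max M₂ M₃), ?_⟩
    filter_upwards [hM₁, he, eventually_gt_atTop 0, eventually_ge_atTop B₀] with B h1 h2 hB hBB
    have hB' : (0 : ℝ) < B := by exact_mod_cast hB
    set M := max M₁ (max M₂ M₃)
    have hMM₃ : (M₃ : ℝ) ≤ M := by
      exact_mod_cast (le_max_right M₂ M₃).trans (le_max_right _ _)
    have key := card_largePrimeSet_succ_le (M := M) hB hd h0 hh
      (fun p hp hMp => hM₂ p hp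
        (((le_max_left M₂ M₃).trans (le_max_right _ _)).trans_lt hMp)) h2
    have t1 : (B : ℝ) * ((finBox r B).filter (· ∈ largePrimeSet (PolyFamilies.coeffFamily S) M)).card
        ≤ η / 3 * (B : ℝ) ^ (r + 1) := by
      have hmono : (((finBox r B).filter
          (· ∈ largePrimeSet (PolyFamilies.coeffFamily S) M)).card : ℝ) ≤
          η / 3 * (B : ℝ) ^ r := by
        refine le_trans ?_ h1
        exact_mod_cast Finset.card_le_card (Finset.monotone_filter_right _
          fun n _ hn => largePrimeSet_anti _ (le_max_left _ _) hn)
      calc _ ≤ (B : ℝ) * (η / 3 * (B : ℝ) ^ r) := by gcongr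
        _ = _ := by ring
    have t2 : (h.totalDegree + 2 * d * e : ℝ) * (B : ℝ) ^ r ≤ η / 3 * (B : ℝ) ^ (r + 1) := by
      have : (h.totalDegree + 2 * d * e : ℝ) ≤ η / 3 * B := by
        rw [div_lt_iff₀ hη] at hB₀
        have : (B₀ : ℝ) ≤ B := by exact_mod_cast hBB
        nlinarith
      calc _ ≤ η / 3 * B * (B : ℝ) ^ r := by gcongr
        _ = _ := by ring
    have t3 : K * (2 / (M + 1)) * (B : ℝ) ^ (r + 1) ≤ η / 3 * (B : ℝ) ^ (r + 1) := by
      gcongr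
      rw [div_lt_iff₀ hη] at hM₃
      rw [mul_div_assoc', div_le_iff₀ (by positivity)]
      nlinarith
    linarith

/-! ### Finite sieve and passage to the limit -/

open Classical in
/-- The common zeros of `S` modulo `p`, as a finite set. -/
noncomputable def zeroFinset {r : ℕ} (S : Finset (MvPolynomial (Fin r) ℤ)) (p : ℕ) [NeZero p] :
    Finset (Fin r → ZMod p) :=
  Finset.univ.filter fun n => ∀ Q ∈ S,
    MvPolynomial.eval n (MvPolynomial.map (Int.castRingHom (ZMod p)) Q) = 0

theorem card_zeroFinset {r : ℕ} (S : Finset (MvPolynomial (Fin r) ℤ)) (p : ℕ) [NeZero p] :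
    (zeroFinset S p).card = zeroCount S p := by
  rw [zeroCount, ← Set.ncard_coe_finset, zeroFinset, Finset.coe_filter]
  simp

theorem intCast_mem_zeroFinset {r : ℕ} {S : Finset (MvPolynomial (Fin r) ℤ)} {p : ℕ} [NeZero p]
    {n : Fin r → ℤ} :
    (fun i => (n i : ZMod p)) ∈ zeroFinset S p ↔
      ∀ Q ∈ S, (p : ℤ) ∣ MvPolynomial.eval n Q := by
  simp only [zeroFinset, Finset.mem_filter, Finset.mem_univ, true_and, eval_map_intCast,
    ZMod.intCast_zmod_eq_zero_iff_dvd]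

theorem zeroCount_le {r : ℕ} (S : Finset (MvPolynomial (Fin r) ℤ)) (p : ℕ) [NeZero p] :
    zeroCount S p ≤ p ^ r := by
  rw [← card_zeroFinset]
  simpa using Finset.card_le_univ (zeroFinset S p)

instance neZeroPrimes (p : Nat.Primes) : NeZero (p : ℕ) := ⟨p.2.ne_zero⟩

-- The Chinese remainder theorem turns the conditions at the primes of `P` into a set of classes
-- modulo their product, whose size is the product of the local counts.
open Classical in
theorem tendsto_card_sieve {r : ℕ} (S : Finset (MvPolynomial (Fin r) ℤ)) (P : Finset Nat.Primes) :
    Tendsto (fun B : ℕ => (((finBox r B).filter fun n => ∀ p ∈ P,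
      ¬ ∀ Q ∈ S, ((p : ℕ) : ℤ) ∣ MvPolynomial.eval n Q).card : ℝ) / (B : ℝ) ^ r) atTop
      (𝓝 (∏ p ∈ P, (1 - (zeroCount S (p : ℕ) : ℝ) / ((p : ℕ) : ℝ) ^ r))) := by
  have hcop : Pairwise (Function.onFun Nat.Coprime fun p : P => ((p : Nat.Primes) : ℕ)) := by
    intro p q hpq
    refine (Nat.coprime_primes p.1.2 q.1.2).2 fun h => hpq ?_
    exact Subtype.ext (Subtype.ext h)
  set N : ℕ := ∏ p : P, ((p : Nat.Primes) : ℕ) with hN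
  have : NeZero N := ⟨Finset.prod_ne_zero_iff.2 fun p _ => p.1.2.ne_zero⟩
  let e : ZMod N ≃+* ∀ p : P, ZMod ((p : Nat.Primes) : ℕ) := ZMod.prodEquivPi _ hcop
  let E : (Fin r → ZMod N) ≃ (∀ p : P, Fin r → ZMod ((p : Nat.Primes) : ℕ)) :=
    (Equiv.piCongrRight fun _ => e.toEquiv).trans (Equiv.piComm _)
  have hE : ∀ (w : Fin r → ZMod N) (p : P) (i : Fin r), E w p i = e (w i) p := fun _ _ _ => rfl
  set A : Finset (∀ p : P, Fin r → ZMod ((p : Nat.Primes) : ℕ)) :=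
    Fintype.piFinset fun p : P => (zeroFinset S ((p : Nat.Primes) : ℕ))ᶜ with hA
  have hlim := tendsto_card_filter_residues r N (A.map E.symm.toEmbedding)
  have hval : ((A.map E.symm.toEmbedding).card : ℝ) / (N : ℝ) ^ r =
      ∏ p ∈ P, (1 - (zeroCount S (p : ℕ) : ℝ) / ((p : ℕ) : ℝ) ^ r) := by
    rw [Finset.card_map, hA, Fintype.card_piFinset, hN, Nat.cast_prod, Nat.cast_prod,
      ← Finset.prod_pow, ← Finset.prod_div_distrib, ← Finset.prod_coe_sort P]
    refine Finset.prod_congr rfl fun p _ => ?_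
    have hp : ((((p : Nat.Primes) : ℕ) : ℝ) ^ r) ≠ 0 := by
      exact_mod_cast pow_ne_zero r p.1.2.ne_zero
    rw [Finset.card_compl, card_zeroFinset, Fintype.card_fun, ZMod.card, Fintype.card_fin,
      Nat.cast_sub (zeroCount_le S _), sub_div, Nat.cast_pow, div_self hp]
  rw [hval] at hlim
  refine hlim.congr fun B => ?_
  congr 3
  refine Finset.filter_congr fun n _ => ?_
  rw [Finset.mem_map_equiv, Equiv.symm_symm, hA, Fintype.mem_piFinset]
  have hEn : ∀ p : P, E (fun i => (n i : ZMod N)) p =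
      fun i => (n i : ZMod ((p : Nat.Primes) : ℕ)) := by
    intro p
    funext i
    rw [hE, map_intCast, Pi.intCast_apply]
  simp only [hEn, Finset.mem_compl, intCast_mem_zeroFinset, Subtype.forall]

/-- The right side also excludes gcd 0, as every prime divides 0. -/
theorem mem_goodSet_iff {r : ℕ} {S : Finset (MvPolynomial (Fin r) ℤ)} {n : Fin r → ℤ} :
    n ∈ goodSet S ↔ ∀ p : ℕ, p.Prime → ¬ ∀ Q ∈ S, (p : ℤ) ∣ MvPolynomial.eval n Q := by
  change S.gcd (fun P => MvPolynomial.eval n P) = 1 ↔ _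
  simp only [← Finset.dvd_gcd_iff (f := fun P => MvPolynomial.eval n P)]
  constructor
  · intro h p hp hdvd
    rw [h] at hdvd
    exact hp.one_lt.ne' (by exact_mod_cast Int.eq_one_of_dvd_one (by positivity) hdvd)
  · intro h
    have h1 : (S.gcd fun P => MvPolynomial.eval n P).natAbs = 1 := by
      rw [Nat.eq_one_iff_not_exists_prime_dvd]
      exact fun p hp hdvd => h p hp (Int.natCast_dvd.2 hdvd)
    rw [← Finset.normalize_gcd, ← Int.abs_eq_normalize, Int.abs_eq_natAbs, h1, Nat.cast_one]

/-- The finite partial products decrease and are bounded below by 0; the limit may be 0. -/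
theorem hasProd_iInf_of_mem_Icc {ι : Type*} {f : ι → ℝ} (h0 : ∀ i, 0 ≤ f i) (h1 : ∀ i, f i ≤ 1) :
    HasProd f (⨅ s : Finset ι, ∏ i ∈ s, f i) := by
  classical
  have hanti : Antitone fun s : Finset ι => ∏ i ∈ s, f i := by
    intro s t hst
    dsimp only
    rw [← Finset.prod_sdiff hst]
    exact mul_le_of_le_one_left (Finset.prod_nonneg fun i _ => h0 i)
      (Finset.prod_le_one (fun i _ => h0 i) fun i _ => h1 i)
  rw [HasProd, SummationFilter.unconditional_filter]
  refine tendsto_atTop_ciInf hanti ⟨0, ?_⟩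
  rintro _ ⟨s, rfl⟩
  exact Finset.prod_nonneg fun i _ => h0 i

open Classical in
/-- The good set of a coprime family has a density, given by the product of the local densities. -/
theorem UnitCommonDivisors.exists_hasProd_hasDensity {r : ℕ}
    {S : Finset (MvPolynomial (Fin r) ℤ)} (hS : UnitCommonDivisors S) :
    ∃ δ : ℝ, HasProd (fun p : Nat.Primes =>
      1 - (zeroCount S (p : ℕ) : ℝ) / ((p : ℕ) : ℝ) ^ r) δ ∧ HasDensity (goodSet S) δ := by
  have hprod := hasProd_iInf_of_mem_Icc (f := fun p : Nat.Primes =>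
      1 - (zeroCount S (p : ℕ) : ℝ) / ((p : ℕ) : ℝ) ^ r)
    (fun p => by
      have : (zeroCount S (p : ℕ) : ℝ) ≤ ((p : ℕ) : ℝ) ^ r := by exact_mod_cast zeroCount_le S p
      exact sub_nonneg.2 (div_le_one_of_le₀ this (by positivity)))
    (fun p => sub_le_self _ (by positivity))
  set δ := ⨅ s : Finset Nat.Primes,
    ∏ p ∈ s, (1 - (zeroCount S (p : ℕ) : ℝ) / ((p : ℕ) : ℝ) ^ r)
  refine ⟨δ, hprod, ?_⟩
  rw [HasDensity, Metric.tendsto_nhds]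
  intro ε hε
  obtain ⟨M, hM⟩ := hS.exists_card_largePrimeSet_le (η := ε / 3) (by positivity)
  rw [HasProd, SummationFilter.unconditional_filter, Metric.tendsto_atTop] at hprod
  obtain ⟨P₀, hP₀⟩ := hprod (ε / 3) (by positivity)
  -- With all primes up to `M` included, a point that survives `P` without being good has a common
  -- prime divisor above `M`.
  set P : Finset Nat.Primes := P₀ ∪ (Finset.range (M + 1)).subtype Nat.Prime with hP
  have hPδ := hP₀ P Finset.subset_union_left
  have hmemP : ∀ p : Nat.Primes, (p : ℕ) ≤ M → p ∈ P := fun p hp =>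
    Finset.mem_union_right _ (Finset.mem_subtype.2 (Finset.mem_range.2 (Nat.lt_succ_of_le hp)))
  filter_upwards [hM, Metric.tendsto_nhds.1 (tendsto_card_sieve S P) (ε / 3) (by positivity),
    eventually_gt_atTop 0] with B h1 h2 hB
  have hBr : (0 : ℝ) < (B : ℝ) ^ r := by
    have : (0 : ℝ) < B := by exact_mod_cast hB
    positivity
  rw [ncard_inter_box, ncard_box, Nat.cast_pow]
  set X := (finBox r B).filter (· ∈ goodSet S) with hX
  set Y := (finBox r B).filter fun n => ∀ p ∈ P,
      ¬ ∀ Q ∈ S, ((p : ℕ) : ℤ) ∣ MvPolynomial.eval n Q with hY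
  set Z := (finBox r B).filter (· ∈ largePrimeSet S M) with hZ
  have hXY : (X.card : ℝ) ≤ Y.card := by
    refine Nat.cast_le.2 (Finset.card_le_card fun n hn => ?_)
    rw [hX, Finset.mem_filter, mem_goodSet_iff] at hn
    exact Finset.mem_filter.2 ⟨hn.1, fun p _ => hn.2 p p.2⟩
  have hYXZ : (Y.card : ℝ) ≤ X.card + Z.card := by
    have hsub : Y ⊆ X ∪ Z := by
      intro n hn
      rw [hY, Finset.mem_filter] at hn
      rw [Finset.mem_union, hX, hZ, Finset.mem_filter, Finset.mem_filter]
      by_cases hg : n ∈ goodSet S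
      · exact Or.inl ⟨hn.1, hg⟩
      · refine Or.inr ⟨hn.1, ?_⟩
        rw [mem_goodSet_iff] at hg
        push Not at hg
        obtain ⟨p, hp, hall⟩ := hg
        refine ⟨p, hp, ?_, hall⟩
        by_contra! hpM
        exact hn.2 ⟨p, hp⟩ (hmemP ⟨p, hp⟩ hpM) hall
    exact_mod_cast (Finset.card_le_card hsub).trans (Finset.card_union_le _ _)
  have hq1 : (X.card : ℝ) / (B : ℝ) ^ r ≤ Y.card / (B : ℝ) ^ r := by gcongr
  have hq2 : (Y.card : ℝ) / (B : ℝ) ^ r ≤ X.card / (B : ℝ) ^ r + ε / 3 := by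
    rw [div_add' _ _ _ hBr.ne']
    gcongr
    linarith
  rw [Real.dist_eq, abs_lt] at h2 hPδ ⊢
  constructor <;> linarith

/-! ### From several families to their products -/

theorem forall_products_dvd_iff {r ℓ : ℕ} (F : Fin ℓ → Finset (MvPolynomial (Fin r) ℤ))
    {p : ℕ} (hp : p.Prime) (n : Fin r → ℤ) :
    (∀ Q ∈ products F, (p : ℤ) ∣ MvPolynomial.eval n Q) ↔
      ∃ j, ∀ P ∈ F j, (p : ℤ) ∣ MvPolynomial.eval n P := by
  constructor
  · intro h
    by_contra! hcon
    choose A hAF hA using hcon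
    have := h (∏ j, A j) (Finset.mem_image_of_mem _ (Fintype.mem_piFinset.2 hAF))
    rw [map_prod, (Nat.prime_iff_prime_int.1 hp).dvd_finsetProd_iff] at this
    obtain ⟨j, -, hj⟩ := this
    exact hA j hj
  · rintro ⟨j, hj⟩ Q hQ
    obtain ⟨A, hA, rfl⟩ := Finset.mem_image.1 hQ
    rw [map_prod]
    exact (hj _ (Fintype.mem_piFinset.1 hA j)).trans (Finset.dvd_prod_of_mem _ (Finset.mem_univ j))

/-- An irreducible factor of a common divisor is prime, as ℚ[x] is factorial; it misses a member of
each family, hence their product. -/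
theorem coprimePolys_products {r ℓ : ℕ} {F : Fin ℓ → Finset (MvPolynomial (Fin r) ℤ)}
    (hcop : ∀ j, CoprimePolys (F j)) : CoprimePolys (products F) := by
  rintro ⟨D, hD, hdvd⟩
  have hD0 : D ≠ 0 := by
    rintro rfl
    simp at hD
  obtain ⟨E, hE, hED⟩ := WfDvdMonoid.exists_irreducible_factor
    (fun hu => hD.ne' ((isUnit_iff_rat D).1 hu).2) hD0
  have hEdeg : 0 < E.totalDegree := Nat.pos_of_ne_zero fun h0 =>
    hE.not_isUnit ((isUnit_iff_rat E).2 ⟨hE.ne_zero, h0⟩)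
  have hex : ∀ j, ∃ P ∈ F j, ¬ E ∣ MvPolynomial.map (Int.castRingHom ℚ) P := by
    intro j
    by_contra! hall
    exact hcop j ⟨E, hEdeg, hall⟩
  choose A hAF hA using hex
  have := hED.trans (hdvd (∏ j, A j) (Finset.mem_image_of_mem _ (Fintype.mem_piFinset.2 hAF)))
  rw [map_prod, hE.prime.dvd_finsetProd_iff] at this
  obtain ⟨j, -, hj⟩ := this
  exact hA j hj

theorem zeroCount_eq_pow_iff {r : ℕ} (S : Finset (MvPolynomial (Fin r) ℤ)) (p : ℕ) [NeZero p] :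
    zeroCount S p = p ^ r ↔ ∀ n : Fin r → ℤ, ∀ Q ∈ S, (p : ℤ) ∣ MvPolynomial.eval n Q := by
  have hcard : Fintype.card (Fin r → ZMod p) = p ^ r := by simp
  rw [← card_zeroFinset, ← hcard, Finset.card_eq_iff_eq_univ]
  constructor
  · intro h n
    rw [← intCast_mem_zeroFinset, h]
    exact Finset.mem_univ _
  · intro h
    refine Finset.eq_univ_iff_forall.2 fun w => ?_
    have := intCast_mem_zeroFinset.2 (h fun i => ((w i).val : ℤ))
    simpa using this

end PolyFamilies

theorem proposition6p3 (r ℓ : ℕ) (hr : 1 ≤ r) (hℓ : 1 ≤ ℓ)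
    (F : Fin ℓ → Finset (MvPolynomial (Fin r) ℤ))
    (hne : ∀ j, ∀ P ∈ F j, P ≠ 0)
    (hcop : ∀ j, PolyFamilies.CoprimePolys (F j)) :
    -- (a)
    ((∀ Q ∈ PolyFamilies.products F, Q ≠ 0) ∧
      PolyFamilies.CoprimePolys (PolyFamilies.products F)) ∧
    -- (b)
    (⋂ j, PolyFamilies.goodSet (F j)) = PolyFamilies.goodSet (PolyFamilies.products F) ∧
    -- (c)
    (∃ δ : ℝ,
      HasProd (fun p : Nat.Primes =>
        1 - (PolyFamilies.zeroCount (PolyFamilies.products F) (p : ℕ) : ℝ) / ((p : ℕ) : ℝ) ^ r) δ ∧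
      PolyFamilies.HasDensity (⋂ j, PolyFamilies.goodSet (F j)) δ) ∧
    -- (d)
    (∀ p : ℕ, p.Prime →
      (PolyFamilies.zeroCount (PolyFamilies.products F) p = p ^ r ↔
        ∀ n : Fin r → ℤ, ∃ j, ∀ P ∈ F j, (p : ℤ) ∣ MvPolynomial.eval n P)) := by
  have hprod := PolyFamilies.coprimePolys_products hcop
  have hgood : (⋂ j, PolyFamilies.goodSet (F j)) =
      PolyFamilies.goodSet (PolyFamilies.products F) := by
    ext n
    simp only [Set.mem_iInter, PolyFamilies.mem_goodSet_iff]
    constructor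
    · intro h p hp hall
      obtain ⟨j, hj⟩ := (PolyFamilies.forall_products_dvd_iff F hp n).1 hall
      exact h j p hp hj
    · intro h j p hp hall
      exact h p hp ((PolyFamilies.forall_products_dvd_iff F hp n).2 ⟨j, hall⟩)
  refine ⟨⟨fun Q hQ => ?_, hprod⟩, hgood, ?_, fun p hp => ?_⟩
  · obtain ⟨A, hA, rfl⟩ := Finset.mem_image.1 hQ
    exact Finset.prod_ne_zero_iff.2 fun j _ => hne j _ (Fintype.mem_piFinset.1 hA j)
  · rw [hgood]
    exact (hprod.unitCommonDivisors hr).exists_hasProd_hasDensity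
  · have : NeZero p := ⟨hp.ne_zero⟩
    rw [PolyFamilies.zeroCount_eq_pow_iff]
    exact forall_congr' fun n => PolyFamilies.forall_products_dvd_iff F hp n
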